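/- Let $a_n>0$ and $b_n\in\mathbb R$ $(n\ge 0)$. Put $\alpha_n=\sqrt{a_{n+1}/a_n}$ for $n\ge 0$, $k_n=\alpha_{n-1}/\alpha_n$ and $\beta_n=-\dfrac{b_n}{2\sqrt{a_{n-1}a_n}}$ for $n\ge 1$, and let $\beta_0\in\mathbb R$ be arbitrary. Assume that $$\sum_{n\ge 0} a_n^{-1}<\infty,\qquad \beta_n\to\beta_\infty\ \text{ with }\ |\beta_\infty|<1,\qquad \sum_{n\ge 1}|k_n-1|<\infty,\qquad \sum_{n\ge 0}|\beta_{n+1}-\beta_n|<\infty .$$ Define the Jacobi matrix $\mathcal J$ on complex sequences by $(\mathcal Ju)_0=b_0u_0+a_0u_1$ and $(\mathcal Ju)_n=a_{n-1}u_{n-1}+b_nu_n+a_nu_{n+1}$ for $n\ge1$. In $\ell^2(\mathbb Z_+)$ let $J_{\min}$ be the restriction of $\mathcal J$ to sequences with finitely many non-zero components, and $J_{\max}$ the restriction of $\mathcal J$ to all $u\in\ell^2(\mathbb Z_+)$ with $\mathcal Ju\in\ell^2(\mathbb Z_+)$. Let $$\varphi_n=\sum_{0\le m\le n-1,\ |\beta_m|\le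 1}\arccos\beta_m .$$ Then every $u\in\mathcal D(J_{\max})$ has an asymptotic expansion $$u_n=a_n^{-1/2}\big(s_+e^{i\varphi_n}+s_-e^{-i\varphi_n}+o(1)\big),\qquad n\to\infty,$$ with uniquely determined coefficients $s_\pm=s_\pm(u)\in\mathbb C$. For $\omega\in\mathbb T=\{\omega\in\mathbb C:|\omega|=1\}$ let $\mathbf J_\omega$ be the restriction of $J_{\max}$ to $\{u\in\mathcal D(J_{\max}): s_+(u)=\omega s_-(u)\}$. Then for every $\omega\in\mathbb T$ the operator $\mathbf J_\omega$ is self-adjoint. Conversely, every operator $J$ with $J_{\min}\subset J=J^*\subset J_{\max}$ equals $\mathbf J_\omega$ for some $\omega\in\mathbb T$. -/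

import Mathlib

open Filter Topology

noncomputable section

/-- The Hilbert space `ℓ²(ℤ₊)` of square summable complex sequences. -/
abbrev EllTwo : Type := lp (fun _ : ℕ => ℂ) 2

/-- The formal action of the Jacobi matrix with off-diagonal entries `a` and diagonal entries `b`
on an arbitrary sequence. -/
def jacobiAct (a b : ℕ → ℝ) (u : ℕ → ℂ) : ℕ → ℂ
  | 0 => b 0 * u 0 + a 0 * u 1
  | n + 1 => a n * u n + b (n + 1) * u (n + 1) + a (n + 1) * u (n + 2)

theorem jacobiAct_add (a b : ℕ → ℝ) (u v : ℕ → ℂ) :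
    jacobiAct a b (u + v) = jacobiAct a b u + jacobiAct a b v := by
  funext n
  cases n <;> simp only [jacobiAct, Pi.add_apply] <;> ring

theorem jacobiAct_smul (a b : ℕ → ℝ) (c : ℂ) (u : ℕ → ℂ) :
    jacobiAct a b (c • u) = c • jacobiAct a b u := by
  funext n
  cases n <;> simp only [jacobiAct, Pi.smul_apply, smul_eq_mul] <;> ring

/-- The maximal Jacobi operator: the formal action on all `u ∈ ℓ²` whose image is in `ℓ²`. -/
def jacobiMax (a b : ℕ → ℝ) : EllTwo →ₗ.[ℂ] EllTwo where
  domain :=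
    { carrier := {u | Memℓp (jacobiAct a b (u : ℕ → ℂ)) 2}
      zero_mem' := by
        have h : jacobiAct a b ((0 : EllTwo) : ℕ → ℂ) = 0 := by
          have h0 := jacobiAct_smul a b 0 0
          rw [zero_smul, zero_smul] at h0
          exact h0
        change Memℓp (jacobiAct a b ((0 : EllTwo) : ℕ → ℂ)) 2
        rw [h]
        exact zero_memℓp
      add_mem' := by
        intro u v hu hv
        have h := Memℓp.add hu hv
        simpa only [Set.mem_ofPred_eq, lp.coeFn_add, jacobiAct_add] using h
      smul_mem' := by
        intro c u hu
        have h := Memℓp.const_smul hu c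
        simpa only [Set.mem_ofPred_eq, lp.coeFn_smul, jacobiAct_smul] using h }
  toFun :=
    { toFun := fun u => ⟨jacobiAct a b ((u : EllTwo) : ℕ → ℂ), u.2⟩
      map_add' := fun u v => Subtype.ext (jacobiAct_add a b _ _)
      map_smul' := fun c u => Subtype.ext (jacobiAct_smul a b c _) }

theorem mem_jacobiMax_domain (a b : ℕ → ℝ) (u : EllTwo) :
    u ∈ (jacobiMax a b).domain ↔ Memℓp (jacobiAct a b (u : ℕ → ℂ)) 2 := Iff.rfl

theorem jacobiMax_apply (a b : ℕ → ℝ) (u : (jacobiMax a b).domain) :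
    ((jacobiMax a b u : EllTwo) : ℕ → ℂ) = jacobiAct a b ((u : EllTwo) : ℕ → ℂ) := rfl

/-- The vectors of `ℓ²` with only finitely many non-zero components. -/
def finiteVectors : Submodule ℂ EllTwo where
  carrier := {u | (Function.support (u : ℕ → ℂ)).Finite}
  zero_mem' := by
    have h : Function.support ((0 : EllTwo) : ℕ → ℂ) = ∅ := Function.support_zero
    change (Function.support ((0 : EllTwo) : ℕ → ℂ)).Finite
    rw [h]
    exact Set.finite_empty
  add_mem' := by
    intro u v hu hv
    exact (Set.Finite.union hu hv).subset (Function.support_add (u : ℕ → ℂ) (v : ℕ → ℂ))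
  smul_mem' := by
    intro c u hu
    exact Set.Finite.subset hu (Function.support_const_smul_subset c (u : ℕ → ℂ))

/-- The minimal Jacobi operator: the formal action on the finite vectors. -/
def jacobiMin (a b : ℕ → ℝ) : EllTwo →ₗ.[ℂ] EllTwo :=
  (jacobiMax a b).domRestrict finiteVectors

/-- The domain of the minimal operator consists of all finite vectors: a Jacobi matrix maps
finite vectors to finite vectors. -/
theorem mem_jacobiMin_domain (a b : ℕ → ℝ) (u : EllTwo) :
    u ∈ (jacobiMin a b).domain ↔ (Function.support (u : ℕ → ℂ)).Finite := by
  refine ⟨fun h => h.1, fun h => ⟨h, ?_⟩⟩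
  change Memℓp (jacobiAct a b (u : ℕ → ℂ)) 2
  obtain ⟨N, hN⟩ := h.bddAbove
  have hz : ∀ n, N < n → (u : ℕ → ℂ) n = 0 := by
    intro n hn
    by_contra hne
    exact absurd (hN hne) (not_le.mpr hn)
  refine (memℓp_zero ((Set.finite_Iic (N + 1)).subset ?_)).of_exponent_ge zero_le
  intro n hn
  by_contra hlt
  apply hn
  rw [Set.mem_Iic, not_le] at hlt
  obtain ⟨m, rfl⟩ : ∃ m, n = m + 1 := ⟨n - 1, by omega⟩
  simp [jacobiAct, hz m (by omega), hz (m + 1) (by omega), hz (m + 2) (by omega)]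

/-- `α_n = √(a_{n+1} / a_n)`. -/
def jacobiAlpha (a : ℕ → ℝ) (n : ℕ) : ℝ := √(a (n + 1) / a n)

/-- `k_n = α_{n-1} / α_n` for `n ≥ 1`, with the index shifted by one: the value at `n` is
`k_{n+1}`. -/
def jacobiK (a : ℕ → ℝ) (n : ℕ) : ℝ := jacobiAlpha a n / jacobiAlpha a (n + 1)

/-- `β_n = -b_n / (2 √(a_{n-1} a_n))` for `n ≥ 1`. At `n = 0` this formula has no meaning, and
the value of `β_0` is the free parameter `β₀`. -/
def jacobiBeta (β₀ : ℝ) (a b : ℕ → ℝ) : ℕ → ℝ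
  | 0 => β₀
  | n + 1 => -b (n + 1) / (2 * √(a n * a (n + 1)))

/-- The phase `φ_n`, the sum of `θ_m = arccos β_m` over those `m < n` for which `|β_m| ≤ 1`. -/
def jacobiPhase (β₀ : ℝ) (a b : ℕ → ℝ) (n : ℕ) : ℝ :=
  ∑ m ∈ (Finset.range n).filter (fun m => |jacobiBeta β₀ a b m| ≤ 1),
    Real.arccos (jacobiBeta β₀ a b m)

/-- `u_n = a_n^{-1/2} (s₊ e^{i φ_n} + s₋ e^{-i φ_n} + o(1))` as `n → ∞`, that is, `s₊` and `s₋` are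
the asymptotic coefficients `s₊(u)` and `s₋(u)` of the sequence `u`. -/
def HasAsymptoticCoeffs (a φ : ℕ → ℝ) (u : ℕ → ℂ) (splus sminus : ℂ) : Prop :=
  ∃ ε : ℕ → ℂ, Tendsto ε atTop (𝓝 0) ∧ ∀ n,
    u n = ((√(a n))⁻¹ : ℝ) *
      (splus * Complex.exp (Complex.I * φ n) + sminus * Complex.exp (-(Complex.I * φ n)) + ε n)

/-- The vectors of `ℓ²` that have asymptotic coefficients satisfying `s₊ = ω s₋`. -/
def boundarySubspace (a φ : ℕ → ℝ) (ω : ℂ) : Submodule ℂ EllTwo where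
  carrier := {u | ∃ splus sminus : ℂ,
    HasAsymptoticCoeffs a φ (u : ℕ → ℂ) splus sminus ∧ splus = ω * sminus}
  zero_mem' := ⟨0, 0, ⟨0, tendsto_const_nhds, fun n => by simp⟩, by simp⟩
  add_mem' := by
    rintro u v ⟨p, q, ⟨ε, hε, hu⟩, h⟩ ⟨p', q', ⟨ε', hε', hv⟩, h'⟩
    refine ⟨p + p', q + q', ⟨fun n => ε n + ε' n, by simpa using hε.add hε', fun n => ?_⟩, by rw [h, h']; ring⟩
    rw [lp.coeFn_add, Pi.add_apply, hu, hv]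
    ring
  smul_mem' := by
    rintro c u ⟨p, q, ⟨ε, hε, hu⟩, h⟩
    refine ⟨c * p, c * q, ⟨fun n => c * ε n, by simpa using hε.const_mul c, fun n => ?_⟩,
      by rw [h]; ring⟩
    rw [lp.coeFn_smul, Pi.smul_apply, smul_eq_mul, hu]
    ring

/-- The operator `J_ω`, the restriction of the maximal operator to the vectors `u` of its domain
with `s₊(u) = ω s₋(u)`. -/
def jacobiOmega (β₀ : ℝ) (a b : ℕ → ℝ) (ω : ℂ) : EllTwo →ₗ.[ℂ] EllTwo :=
  (jacobiMax a b).domRestrict (boundarySubspace a (jacobiPhase β₀ a b) ω)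

end

/-! The substitution `v_n = √(a_n) u_n` turns `𝒥u = f` into `v_{n+2} = 2β_{n+1} v_{n+1} - v_n + g_n
- (k_{n+1} - 1) v_{n+2}` with `g_n = f_{n+1} / √(a_n)`. For large `n` its characteristic roots are
`z_{n+1}^{±1}`, where `z_n = exp(i arccos β_n)` is unimodular, has bounded variation and stays away
from `±1`. For `f ∈ ℓ²` all perturbations are summable. The amplitudes `v_{n+1} - z_n^{∓1} v_n`,
divided by their phases, therefore converge, and `v_n` is recovered from the two of them
(`PerturbedRecurrence.exists_asymptotics`).

By Green's formula the boundary form of `J_max` is the limit of the Wronskian. The oscillating cross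
terms cancel, which leaves a multiple of `conj s₊ s₊' - conj s₋ s₋'` (`HasBoundaryForm`). The factor
is non-zero because `lim α_n⁻¹ ≠ 0` and `z_∞ ≠ ±1`. As `∑ a_n⁻¹ < ∞`, every solution of the
homogeneous recurrence lies in `ℓ²`, so each condition `s₊ = ω s₋` is attained with `s₋ ≠ 0`.
Self-adjoint restrictions then correspond to the lines in `ℂ²` that are isotropic for this
indefinite form, namely `s₊ = ω s₋` with `|ω| = 1`. -/

open ComplexConjugate

/-! ### Perturbed recurrences: boundedness and asymptotics. -/

/-- A discrete Gronwall inequality with summable coefficients. -/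
theorem bounded_of_summable_gronwall {X ε g : ℕ → ℝ} (hX : ∀ n, 0 ≤ X n) (hε₀ : ∀ n, 0 ≤ ε n)
    (hg₀ : ∀ n, 0 ≤ g n) (hε : Summable ε) (hg : Summable g)
    (h : ∀ᶠ n in atTop, X (n + 1) ≤ X n + ε n * (X n + X (n + 1)) + g n) :
    ∃ C, ∀ᶠ n in atTop, X n ≤ C := by
  have hsmall : ∀ᶠ n in atTop, ε n ≤ 1 / 2 :=
    (hε.tendsto_atTop_zero.eventually_lt_const (by norm_num : (0 : ℝ) < 1 / 2)).mono
      fun n hn => hn.le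
  obtain ⟨N, hN⟩ := eventually_atTop.1 (h.and hsmall)
  have key : ∀ n, X (N + n) ≤ Real.exp (4 * ∑ k ∈ Finset.range n, ε (N + k)) *
      (X N + 2 * ∑ k ∈ Finset.range n, g (N + k)) := by
    intro n
    induction n with
    | zero => simp
    | succ n ih =>
      obtain ⟨h1, h2⟩ := hN (N + n) (by omega)
      have e0 := hε₀ (N + n)
      have g0 := hg₀ (N + n)
      have x0 := hX (N + n)
      -- Solving the implicit inequality for `X (N + n + 1)`: if `ε ≤ 1/2`, then `(1 + ε)/(1 - ε) ≤
      -- 1 + 4ε` and `1/(1 - ε) ≤ 2`.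
      have step : X (N + n + 1) ≤ (1 + 4 * ε (N + n)) * X (N + n) + 2 * g (N + n) := by
        have h3 : (1 - ε (N + n)) * X (N + n + 1) ≤
            (1 - ε (N + n)) * ((1 + 4 * ε (N + n)) * X (N + n) + 2 * g (N + n)) := by
          have h4 : 0 ≤ (2 * ε (N + n) - 4 * ε (N + n) ^ 2) * X (N + n) := by
            apply mul_nonneg _ x0
            nlinarith
          have h5 : 0 ≤ (1 - 2 * ε (N + n)) * g (N + n) := mul_nonneg (by linarith) g0
          nlinarith
        exact le_of_mul_le_mul_left h3 (by linarith)
      rw [Finset.sum_range_succ, Finset.sum_range_succ, ← add_assoc]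
      set S := ∑ k ∈ Finset.range n, ε (N + k)
      set G := ∑ k ∈ Finset.range n, g (N + k)
      have hS : 0 ≤ S := Finset.sum_nonneg fun k _ => hε₀ _
      have hG : 0 ≤ G := Finset.sum_nonneg fun k _ => hg₀ _
      have hexp : 1 + 4 * ε (N + n) ≤ Real.exp (4 * ε (N + n)) := by
        have := Real.add_one_le_exp (4 * ε (N + n)); linarith
      have hE1 : 1 ≤ Real.exp (4 * (S + ε (N + n))) := Real.one_le_exp (by positivity)
      calc X (N + n + 1) ≤ (1 + 4 * ε (N + n)) * X (N + n) + 2 * g (N + n) := step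
        _ ≤ Real.exp (4 * ε (N + n)) * (Real.exp (4 * S) * (X N + 2 * G)) +
            Real.exp (4 * (S + ε (N + n))) * (2 * g (N + n)) := by
          exact add_le_add (mul_le_mul hexp ih x0 (Real.exp_pos _).le)
            (le_mul_of_one_le_left (by linarith) hE1)
        _ = Real.exp (4 * (S + ε (N + n))) * (X N + 2 * (G + g (N + n))) := by
          rw [mul_add 4 S, Real.exp_add]; ring
  have hshift : ∀ {f : ℕ → ℝ}, (∀ n, 0 ≤ f n) → Summable f → ∀ n,
      ∑ k ∈ Finset.range n, f (N + k) ≤ ∑' k, f k := by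
    intro f hf0 hf n
    rw [← Finset.sum_image (g := fun k => N + k) (f := f) (by simp)]
    exact hf.sum_le_tsum _ fun i _ => hf0 i
  refine ⟨Real.exp (4 * ∑' k, ε k) * (X N + 2 * ∑' k, g k), eventually_atTop.2 ⟨N, fun m hm => ?_⟩⟩
  obtain ⟨n, rfl⟩ := Nat.exists_eq_add_of_le hm
  refine (key n).trans ?_
  have := hX N
  have := hshift hε₀ hε n
  have := hshift hg₀ hg n
  have : 0 ≤ ∑ k ∈ Finset.range n, g (N + k) := Finset.sum_nonneg fun k _ => hg₀ _
  gcongr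

/-- The sequence `v` solves eventually the perturbation `v_{n+2} = (z_{n+1} + z_{n+1}⁻¹) v_{n+1} -
v_n + h_n` of a recurrence with characteristic roots `z_{n+1}`, `z_{n+1}⁻¹`. -/
def PerturbedRecurrence (z g κ v : ℕ → ℂ) : Prop :=
  ∀ᶠ n in atTop, v (n + 2) = (z (n + 1) + (z (n + 1))⁻¹) * v (n + 1) - v n +
    (g n - κ n * v (n + 2))

/-- The two roots play symmetric roles, so each estimate for one amplitude also yields the other. -/
theorem PerturbedRecurrence.inv {z g κ v : ℕ → ℂ} (h : PerturbedRecurrence z g κ v) :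
    PerturbedRecurrence (fun n => (z n)⁻¹) g κ v := by
  filter_upwards [h] with n hn
  rw [inv_inv, add_comm (z (n + 1))⁻¹]
  exact hn

theorem norm_inv_sub_inv_of_norm_eq_one {z w : ℂ} (hz : ‖z‖ = 1) (hw : ‖w‖ = 1) :
    ‖z⁻¹ - w⁻¹‖ = ‖w - z‖ := by
  have hz0 : z ≠ 0 := by rintro rfl; simp at hz
  have hw0 : w ≠ 0 := by rintro rfl; simp at hw
  rw [inv_sub_inv hz0 hw0, norm_div, norm_mul, hz, hw]; simp

theorem ne_zero_of_norm_eq_one {z : ℂ} (hz : ‖z‖ = 1) : z ≠ 0 := by rintro rfl; simp at hz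

section
variable {v z ph g κ : ℕ → ℂ} {zl : ℂ}

/-- With constant roots the second-order difference operator factors, and the amplitude is exactly
multiplied by `z`. The error comes from the variation of `z` and from the perturbations. -/
theorem PerturbedRecurrence.increment (hz : ∀ n, ‖z n‖ = 1) (hrec : PerturbedRecurrence z g κ v) :
    ∀ᶠ n in atTop,
      ‖(v (n + 2) - (z (n + 1))⁻¹ * v (n + 1)) - z (n + 1) * (v (n + 1) - (z n)⁻¹ * v n)‖ ≤
        ‖z (n + 1) - z n‖ * ‖v n‖ + ‖κ n‖ * ‖v (n + 2)‖ + ‖g n‖ := by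
  filter_upwards [hrec] with n hn
  have e : (v (n + 2) - (z (n + 1))⁻¹ * v (n + 1)) - z (n + 1) * (v (n + 1) - (z n)⁻¹ * v n) =
      z (n + 1) * ((z n)⁻¹ - (z (n + 1))⁻¹) * v n + g n - κ n * v (n + 2) := by
    have h1 := mul_inv_cancel₀ (ne_zero_of_norm_eq_one (hz (n + 1)))
    linear_combination hn + v n * h1
  rw [e]
  refine (norm_sub_le _ _).trans ?_
  have := norm_add_le (z (n + 1) * ((z n)⁻¹ - (z (n + 1))⁻¹) * v n) (g n)
  rw [norm_mul, norm_mul, hz, one_mul, norm_inv_sub_inv_of_norm_eq_one (hz _) (hz _)] at this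
  rw [norm_mul (κ n)]
  linarith

theorem PerturbedRecurrence.norm_step (hz : ∀ n, ‖z n‖ = 1)
    (hrec : PerturbedRecurrence z g κ v) :
    ∀ᶠ n in atTop,
      ‖v (n + 2) - (z (n + 1))⁻¹ * v (n + 1)‖ ≤ ‖v (n + 1) - (z n)⁻¹ * v n‖ +
        (‖z (n + 1) - z n‖ * ‖v n‖ + ‖κ n‖ * ‖v (n + 2)‖ + ‖g n‖) := by
  filter_upwards [hrec.increment hz] with n hn
  have h := norm_sub_norm_le (v (n + 2) - (z (n + 1))⁻¹ * v (n + 1))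
    (z (n + 1) * (v (n + 1) - (z n)⁻¹ * v n))
  rw [norm_mul, hz, one_mul] at h
  linarith

theorem PerturbedRecurrence.bounded (hz : ∀ n, ‖z n‖ = 1) (hzl : Tendsto z atTop (𝓝 zl))
    (hzl' : zl - zl⁻¹ ≠ 0) (hzs : Summable fun n => ‖z (n + 1) - z n‖)
    (hκ : Summable fun n => ‖κ n‖) (hg : Summable fun n => ‖g n‖)
    (hrec : PerturbedRecurrence z g κ v) : ∃ C, ∀ n, ‖v n‖ ≤ C := by
  have hzl0 : zl ≠ 0 :=
    ne_zero_of_norm_eq_one (tendsto_nhds_unique hzl.norm (by simp [hz]))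
  set δ := ‖zl - zl⁻¹‖ / 2 with hδ
  have hδ0 : 0 < δ := by have := norm_pos_iff.2 hzl'; positivity
  have hδz : ∀ᶠ n in atTop, δ ≤ ‖z n - (z n)⁻¹‖ :=
    (((hzl.sub (hzl.inv₀ hzl0)).norm).eventually_const_lt
      (by rw [hδ]; linarith [norm_pos_iff.2 hzl'])).mono fun n hn => hn.le
  set X : ℕ → ℝ := fun n => ‖v (n + 1) - (z n)⁻¹ * v n‖ + ‖v (n + 1) - z n * v n‖ with hXdef
  -- The difference of the two amplitudes is `(z_n - z_n⁻¹) v_n`, whose factor is bounded away from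
  -- zero.
  have hv0 : ∀ᶠ n in atTop, ‖v n‖ ≤ X n / δ := by
    filter_upwards [hδz] with n hn
    rw [le_div_iff₀ hδ0]
    calc ‖v n‖ * δ ≤ ‖v n‖ * ‖z n - (z n)⁻¹‖ := by gcongr
      _ = ‖(v (n + 1) - (z n)⁻¹ * v n) - (v (n + 1) - z n * v n)‖ := by
        rw [← norm_mul]; congr 1; ring
      _ ≤ X n := norm_sub_le _ _
  -- Needed at `n + 1`, to control the term `κ n * v (n + 2)` by `X (n + 1)`; this is why the
  -- Gronwall inequality is implicit.
  have hv1 : ∀ᶠ n in atTop, ‖v (n + 1)‖ ≤ X n / δ := by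
    filter_upwards [hδz] with n hn
    rw [le_div_iff₀ hδ0]
    have h1 := mul_inv_cancel₀ (ne_zero_of_norm_eq_one (hz n))
    calc ‖v (n + 1)‖ * δ ≤ ‖v (n + 1)‖ * ‖z n - (z n)⁻¹‖ := by gcongr
      _ = ‖z n * (v (n + 1) - (z n)⁻¹ * v n) - (z n)⁻¹ * (v (n + 1) - z n * v n)‖ := by
        rw [← norm_mul]; congr 1; ring
      _ ≤ X n := by
        refine (norm_sub_le _ _).trans ?_
        rw [norm_mul, norm_mul, norm_inv, hz, inv_one, one_mul, one_mul]
  have hs := hrec.norm_step hz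
  have hs' := hrec.inv.norm_step (z := fun n => (z n)⁻¹) (by simp [hz])
  obtain ⟨C, hC⟩ := bounded_of_summable_gronwall (X := X)
    (ε := fun n => 2 / δ * (‖z (n + 1) - z n‖ + ‖κ n‖)) (g := fun n => 2 * ‖g n‖)
    (fun n => by positivity) (fun n => by positivity) (fun n => by positivity)
    ((hzs.add hκ).mul_left _) (hg.mul_left _) (by
      filter_upwards [hv0, (tendsto_add_atTop_nat 1).eventually hv1, hs, hs'] with n h0 h1 h2 h3
      simp only [inv_inv, norm_inv_sub_inv_of_norm_eq_one (hz _) (hz _)] at h3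
      rw [norm_sub_rev (z n)] at h3
      have a1 : ‖z (n + 1) - z n‖ * ‖v n‖ ≤ ‖z (n + 1) - z n‖ * ((X n + X (n + 1)) / δ) := by
        gcongr
        refine h0.trans ?_
        gcongr
        linarith [show 0 ≤ X (n + 1) by positivity]
      have a2 : ‖κ n‖ * ‖v (n + 2)‖ ≤ ‖κ n‖ * ((X n + X (n + 1)) / δ) := by
        gcongr
        refine h1.trans ?_
        gcongr
        linarith [show 0 ≤ X n by positivity]
      have a3 : 2 / δ * (‖z (n + 1) - z n‖ + ‖κ n‖) * (X n + X (n + 1)) =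
          2 * (‖z (n + 1) - z n‖ * ((X n + X (n + 1)) / δ) +
            ‖κ n‖ * ((X n + X (n + 1)) / δ)) := by ring
      rw [a3]
      have a4 : X (n + 1) = ‖v (n + 2) - (z (n + 1))⁻¹ * v (n + 1)‖ +
        ‖v (n + 2) - z (n + 1) * v (n + 1)‖ := rfl
      have a5 : X n = ‖v (n + 1) - (z n)⁻¹ * v n‖ + ‖v (n + 1) - z n * v n‖ := rfl
      rw [a4] at *
      linarith)
  have hb : ∀ᶠ n in atTop, ‖v n‖ ≤ C / δ := by
    filter_upwards [hv0, hC] with n h0 h1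
    exact h0.trans (by gcongr)
  have hb' : IsBoundedUnder (· ≤ ·) atTop fun n => ‖v n‖ := ⟨_, eventually_map.2 hb⟩
  obtain ⟨C', hC'⟩ := hb'.bddAbove_range
  exact ⟨C', fun n => hC' ⟨n, rfl⟩⟩

/-- Dividing by the phase removes the rotation; once `v` is bounded, the increments are summable. -/
theorem PerturbedRecurrence.tendsto_amplitude (hz : ∀ n, ‖z n‖ = 1) (hph : ∀ n, ‖ph n‖ = 1)
    (hphz : ∀ᶠ n in atTop, ph (n + 1) = ph n * z n)
    (hzs : Summable fun n => ‖z (n + 1) - z n‖)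
    (hκ : Summable fun n => ‖κ n‖) (hg : Summable fun n => ‖g n‖)
    (hrec : PerturbedRecurrence z g κ v) {C : ℝ} (hC : ∀ n, ‖v n‖ ≤ C) :
    ∃ x, Tendsto (fun n => (v (n + 1) - (z n)⁻¹ * v n) * (ph (n + 1))⁻¹) atTop (𝓝 x) := by
  apply cauchySeq_tendsto_of_complete
  apply cauchySeq_of_summable_dist
  refine Summable.of_norm_bounded_eventually_nat
    (g := fun n => ‖z (n + 1) - z n‖ * C + ‖κ n‖ * C + ‖g n‖)
    (((hzs.mul_right _).add (hκ.mul_right _)).add hg) ?_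
  filter_upwards [hrec.increment hz, (tendsto_add_atTop_nat 1).eventually hphz] with n hn hp
  have hp0 := ne_zero_of_norm_eq_one (hph (n + 1))
  have hz0 := ne_zero_of_norm_eq_one (hz (n + 1))
  rw [Real.norm_of_nonneg dist_nonneg, dist_comm, dist_eq_norm]
  have e : (v (n + 1 + 1) - (z (n + 1))⁻¹ * v (n + 1)) * (ph (n + 1 + 1))⁻¹ -
      (v (n + 1) - (z n)⁻¹ * v n) * (ph (n + 1))⁻¹ =
      (ph (n + 2))⁻¹ * ((v (n + 2) - (z (n + 1))⁻¹ * v (n + 1)) -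
        z (n + 1) * (v (n + 1) - (z n)⁻¹ * v n)) := by
    rw [show ph (n + 2) = ph (n + 1) * z (n + 1) from hp, mul_inv]
    linear_combination ((ph (n + 1))⁻¹ * (v (n + 1) - (z n)⁻¹ * v n)) * mul_inv_cancel₀ hz0
  rw [e, norm_mul, norm_inv, hph, inv_one, one_mul]
  refine hn.trans ?_
  gcongr <;> exact hC _

/-- `ph` is a sequence of phases with ratios `z`, of bounded variation and tending to `zl ≠ ±1`. -/
structure IsPhaseSequence (ph z : ℕ → ℂ) (zl : ℂ) : Prop where
  norm_ratio : ∀ n, ‖z n‖ = 1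
  norm_phase : ∀ n, ‖ph n‖ = 1
  phase_succ : ∀ᶠ n in atTop, ph (n + 1) = ph n * z n
  tendsto_ratio : Tendsto z atTop (𝓝 zl)
  limit_ne : zl - zl⁻¹ ≠ 0
  summable_ratio : Summable fun n => ‖z (n + 1) - z n‖

/-- Asymptotics of the solutions of a perturbed recurrence. -/
theorem PerturbedRecurrence.exists_asymptotics (hP : IsPhaseSequence ph z zl)
    (hκ : Summable fun n => ‖κ n‖) (hg : Summable fun n => ‖g n‖)
    (hrec : PerturbedRecurrence z g κ v) :
    ∃ s t, Tendsto (fun n => v n - (s * ph n + t * (ph n)⁻¹)) atTop (𝓝 0) := by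
  obtain ⟨hz, hph, hphz, hzl, hzl', hzs⟩ := hP
  have hzl0 : zl ≠ 0 :=
    ne_zero_of_norm_eq_one (tendsto_nhds_unique hzl.norm (by simp [hz]))
  obtain ⟨C, hC⟩ := hrec.bounded hz hzl hzl' hzs hκ hg
  obtain ⟨x, hx⟩ := hrec.tendsto_amplitude hz hph hphz hzs hκ hg hC
  obtain ⟨y, hy⟩ := hrec.inv.tendsto_amplitude (z := fun n => (z n)⁻¹) (ph := fun n => (ph n)⁻¹)
    (by simp [hz]) (by simp [hph]) (by
      filter_upwards [hphz] with n hn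
      rw [hn, mul_inv]) (by
      refine hzs.congr fun n => ?_
      rw [norm_inv_sub_inv_of_norm_eq_one (hz _) (hz _), norm_sub_rev])
    hκ hg hC
  simp only [inv_inv] at hy
  have hD := hzl.sub (hzl.inv₀ hzl0)
  have hX := (hx.mul hzl).div hD hzl'
  have hY := (hy.mul (hzl.inv₀ hzl0)).div hD hzl'
  -- Limits of the coefficients in the exact formula `hv` below, which solves the two amplitudes for
  -- `v n`.
  refine ⟨x * zl / (zl - zl⁻¹), -(y * zl⁻¹ / (zl - zl⁻¹)), ?_⟩
  have hX0 := (tendsto_sub_nhds_zero_iff.2 hX).norm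
  have hY0 := (tendsto_sub_nhds_zero_iff.2 hY).norm
  rw [norm_zero] at hX0 hY0
  refine squeeze_zero_norm' ?_ (by simpa using hX0.add hY0)
  filter_upwards [hphz, hD.eventually_ne hzl'] with n hn hne
  have hz0 := ne_zero_of_norm_eq_one (hz n)
  have hp0 := ne_zero_of_norm_eq_one (hph n)
  set A := (v (n + 1) - (z n)⁻¹ * v n) * (ph (n + 1))⁻¹ with hA
  set B := (v (n + 1) - z n * v n) * ph (n + 1) with hB
  have hv : v n = A * z n / (z n - (z n)⁻¹) * ph n - B * (z n)⁻¹ / (z n - (z n)⁻¹) * (ph n)⁻¹ := by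
    have e1 : A * z n * ph n = v (n + 1) - (z n)⁻¹ * v n := by
      rw [hA, hn]; field_simp
    have e2 : B * (z n)⁻¹ * (ph n)⁻¹ = v (n + 1) - z n * v n := by
      rw [hB, hn]; field_simp
    have e3 : A * z n / (z n - (z n)⁻¹) * ph n - B * (z n)⁻¹ / (z n - (z n)⁻¹) * (ph n)⁻¹ =
        (A * z n * ph n - B * (z n)⁻¹ * (ph n)⁻¹) / (z n - (z n)⁻¹) := by ring
    rw [e3, e1, e2, eq_div_iff hne]; ring
  have e : v n - (x * zl / (zl - zl⁻¹) * ph n + -(y * zl⁻¹ / (zl - zl⁻¹)) * (ph n)⁻¹) =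
      (A * z n / (z n - (z n)⁻¹) - x * zl / (zl - zl⁻¹)) * ph n -
      (B * (z n)⁻¹ / (z n - (z n)⁻¹) - y * zl⁻¹ / (zl - zl⁻¹)) * (ph n)⁻¹ := by
    rw [hv]; ring
  rw [e]
  refine (norm_sub_le _ _).trans ?_
  rw [norm_mul, norm_mul, norm_inv, hph, inv_one, mul_one, mul_one]
end

/-! ### Uniqueness of the coefficients and the limit of the Casoratian. -/

section
variable {z ph : ℕ → ℂ} {zl : ℂ}

theorem IsPhaseSequence.limit_ne_zero (hP : IsPhaseSequence ph z zl) : zl ≠ 0 :=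
  ne_zero_of_norm_eq_one (tendsto_nhds_unique hP.tendsto_ratio.norm (by simp [hP.norm_ratio]))

theorem IsPhaseSequence.inv (hP : IsPhaseSequence ph z zl) :
    IsPhaseSequence (fun n => (ph n)⁻¹) (fun n => (z n)⁻¹) zl⁻¹ where
  norm_ratio := by simp [hP.norm_ratio]
  norm_phase := by simp [hP.norm_phase]
  phase_succ := hP.phase_succ.mono fun n hn => by simp only [hn, mul_inv]
  tendsto_ratio := hP.tendsto_ratio.inv₀ hP.limit_ne_zero
  limit_ne := by
    rw [inv_inv, ← neg_sub]
    exact neg_ne_zero.2 hP.limit_ne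
  summable_ratio := hP.summable_ratio.congr fun n => by
    rw [norm_inv_sub_inv_of_norm_eq_one (hP.norm_ratio _) (hP.norm_ratio _), norm_sub_rev]

/-- Subtracting `z_n⁻¹` times a term from its successor cancels the `t` part and leaves `s (z_n -
z_n⁻¹) ph_n`, of modulus tending to `‖s‖ ‖zl - zl⁻¹‖`. -/
theorem IsPhaseSequence.eq_zero_of_tendsto (hP : IsPhaseSequence ph z zl) {s t : ℂ}
    (h : Tendsto (fun n => s * ph n + t * (ph n)⁻¹) atTop (𝓝 0)) : s = 0 := by
  have h1 : Tendsto (fun n => (s * ph (n + 1) + t * (ph (n + 1))⁻¹) -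
      (z n)⁻¹ * (s * ph n + t * (ph n)⁻¹)) atTop (𝓝 (0 - zl⁻¹ * 0)) :=
    (h.comp (tendsto_add_atTop_nat 1)).sub
      ((hP.tendsto_ratio.inv₀ hP.limit_ne_zero).mul h)
  have h2 := h1.norm
  have h3 : Tendsto (fun n => ‖s‖ * ‖z n - (z n)⁻¹‖) atTop (𝓝 (‖s‖ * ‖zl - zl⁻¹‖)) :=
    ((hP.tendsto_ratio.sub (hP.tendsto_ratio.inv₀ hP.limit_ne_zero)).norm).const_mul _
  have h4 : ‖s‖ * ‖zl - zl⁻¹‖ = ‖0 - zl⁻¹ * 0‖ := by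
    refine tendsto_nhds_unique (h3.congr' ?_) h2
    filter_upwards [hP.phase_succ] with n hn
    have e : (s * ph (n + 1) + t * (ph (n + 1))⁻¹) - (z n)⁻¹ * (s * ph n + t * (ph n)⁻¹) =
        s * (z n - (z n)⁻¹) * ph n := by
      rw [hn, mul_inv]; ring
    rw [e, norm_mul, norm_mul, hP.norm_phase, mul_one]
  simpa [hP.limit_ne] using h4

theorem IsPhaseSequence.coeffs_unique (hP : IsPhaseSequence ph z zl) {v : ℕ → ℂ} {s t s' t' : ℂ}
    (h : Tendsto (fun n => v n - (s * ph n + t * (ph n)⁻¹)) atTop (𝓝 0))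
    (h' : Tendsto (fun n => v n - (s' * ph n + t' * (ph n)⁻¹)) atTop (𝓝 0)) :
    s = s' ∧ t = t' := by
  have h1 := h'.sub h
  rw [sub_zero] at h1
  constructor
  · refine sub_eq_zero.1 (hP.eq_zero_of_tendsto (t := t - t') (h1.congr fun n => ?_))
    ring
  · refine sub_eq_zero.1 (hP.inv.eq_zero_of_tendsto (t := s - s') (h1.congr fun n => ?_))
    rw [inv_inv]
    ring

theorem tendsto_mul_sub_mul_zero {x y p q : ℕ → ℂ} {C D : ℝ} (hp : ∀ n, ‖p n‖ ≤ C)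
    (hq : ∀ n, ‖q n‖ ≤ D) (hx : Tendsto (fun n => x n - p n) atTop (𝓝 0))
    (hy : Tendsto (fun n => y n - q n) atTop (𝓝 0)) :
    Tendsto (fun n => x n * y n - p n * q n) atTop (𝓝 0) := by
  have hx' := hx.norm
  have hy' := hy.norm
  rw [norm_zero] at hx' hy'
  refine squeeze_zero_norm (a := fun n => ‖x n - p n‖ * ‖y n - q n‖ + C * ‖y n - q n‖ +
    ‖x n - p n‖ * D) (fun n => ?_) (by
      simpa using ((hx'.mul hy').add (hy'.const_mul C)).add (hx'.mul_const D))
  rw [show x n * y n - p n * q n =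
    (x n - p n) * (y n - q n) + p n * (y n - q n) + (x n - p n) * q n by ring]
  refine (norm_add₃_le).trans ?_
  rw [norm_mul, norm_mul, norm_mul]
  gcongr
  · exact hp n
  · exact hq n

theorem conj_eq_inv_of_norm_eq_one {w : ℂ} (hw : ‖w‖ = 1) : conj w = w⁻¹ := by
  rw [Complex.inv_def, Complex.normSq_eq_norm_sq, hw]; simp

/-- For the leading terms the oscillating products with `ph^{±2}` cancel exactly, while the others
lose their phases. -/
theorem IsPhaseSequence.tendsto_casoratian (hP : IsPhaseSequence ph z zl) {u v : ℕ → ℂ}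
    {s t s' t' : ℂ} (hu : Tendsto (fun n => u n - (s * ph n + t * (ph n)⁻¹)) atTop (𝓝 0))
    (hv : Tendsto (fun n => v n - (s' * ph n + t' * (ph n)⁻¹)) atTop (𝓝 0)) :
    Tendsto (fun n => conj (u (n + 1)) * v n - conj (u n) * v (n + 1)) atTop
      (𝓝 (-(zl - zl⁻¹) * (conj s * s' - conj t * t'))) := by
  have hb : ∀ (c d : ℂ) n, ‖c * ph n + d * (ph n)⁻¹‖ ≤ ‖c‖ + ‖d‖ := fun c d n => by
    refine (norm_add_le _ _).trans ?_
    rw [norm_mul, norm_mul, norm_inv, hP.norm_phase]; simp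
  have hb' : ∀ (c d : ℂ) n, ‖conj (c * ph n + d * (ph n)⁻¹)‖ ≤ ‖c‖ + ‖d‖ := fun c d n => by
    rw [Complex.norm_conj]; exact hb c d n
  have hcu : Tendsto (fun n => conj (u n) - conj (s * ph n + t * (ph n)⁻¹)) atTop (𝓝 0) := by
    have := (Complex.continuous_conj.tendsto 0).comp hu
    simpa [Function.comp_def] using this
  have h1 := tendsto_mul_sub_mul_zero (fun n => hb' s t (n + 1)) (hb s' t')
    (hcu.comp (tendsto_add_atTop_nat 1)) hv
  have h2 := tendsto_mul_sub_mul_zero (hb' s t) (fun n => hb s' t' (n + 1)) hcu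
    (hv.comp (tendsto_add_atTop_nat 1))
  have h3 := ((hP.tendsto_ratio.sub (hP.tendsto_ratio.inv₀ hP.limit_ne_zero)).neg).mul_const
    (conj s * s' - conj t * t')
  have h4 := (h1.sub h2).add h3
  rw [sub_zero, zero_add] at h4
  refine h4.congr' ?_
  filter_upwards [hP.phase_succ] with n hn
  have hp0 := ne_zero_of_norm_eq_one (hP.norm_phase n)
  have hz0 := ne_zero_of_norm_eq_one (hP.norm_ratio n)
  simp only [map_add, map_mul, map_inv₀, conj_eq_inv_of_norm_eq_one (hP.norm_phase _), hn,
    conj_eq_inv_of_norm_eq_one (hP.norm_ratio _), inv_inv, mul_inv]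
  field_simp
  ring
end

/-! ### Green's formula and the asymptotics for the Jacobi matrix. -/

section
variable {a b : ℕ → ℝ}

/-- The Wronskian of two sequences, with the complex conjugate of the first one. -/
noncomputable def jacobiWronskian (a : ℕ → ℝ) (u v : ℕ → ℂ) (n : ℕ) : ℂ :=
  a n * (conj (u (n + 1)) * v n - conj (u n) * v (n + 1))

/-- The sum telescopes; there is no boundary term at `0` because the first row has no left
neighbour. -/
theorem sum_green (a b : ℕ → ℝ) (u v : ℕ → ℂ) (n : ℕ) :
    ∑ m ∈ Finset.range (n + 1), (conj (jacobiAct a b u m) * v m - conj (u m) * jacobiAct a b v m) =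
      jacobiWronskian a u v n := by
  induction n with
  | zero => simp [jacobiAct, jacobiWronskian]; ring
  | succ n ih =>
    rw [Finset.sum_range_succ, ih]
    simp [jacobiAct, jacobiWronskian]; ring

theorem hasAsymptoticCoeffs_iff (ha : ∀ n, 0 < a n) {φ : ℕ → ℝ} {u : ℕ → ℂ} {s t : ℂ} :
    HasAsymptoticCoeffs a φ u s t ↔
      Tendsto (fun n => (√(a n) : ℂ) * u n - (s * Complex.exp (Complex.I * φ n) +
        t * (Complex.exp (Complex.I * φ n))⁻¹)) atTop (𝓝 0) := by
  have hr : ∀ n, (√(a n) : ℂ) ≠ 0 := fun n => by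
    exact_mod_cast (Real.sqrt_pos.2 (ha n)).ne'
  constructor
  · rintro ⟨ε, hε, h⟩
    refine hε.congr fun n => ?_
    rw [h n, Complex.ofReal_inv, mul_inv_cancel_left₀ (hr n), Complex.exp_neg]
    ring
  · refine fun h => ⟨_, h, fun n => ?_⟩
    rw [Complex.ofReal_inv, Complex.exp_neg, add_sub_cancel, inv_mul_cancel_left₀ (hr n)]

theorem jacobi_perturbedRecurrence (ha : ∀ n, 0 < a n) {β₀ : ℝ} {z : ℕ → ℂ}
    (hz : ∀ᶠ n in atTop, z n + (z n)⁻¹ = 2 * jacobiBeta β₀ a b n) (u : ℕ → ℂ) :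
    PerturbedRecurrence z (fun n => jacobiAct a b u (n + 1) / √(a n))
      (fun n => ((jacobiK a n - 1 : ℝ) : ℂ)) (fun n => √(a n) * u n) := by
  filter_upwards [(tendsto_add_atTop_nat 1).eventually hz] with n hn
  rw [hn]
  have hr : ∀ n, (√(a n) : ℂ) ≠ 0 := fun n => by
    exact_mod_cast (Real.sqrt_pos.2 (ha n)).ne'
  have hsq : ∀ n, (a n : ℂ) = (√(a n) : ℂ) ^ 2 := fun n => by
    exact_mod_cast (Real.sq_sqrt (ha n).le).symm
  simp only [jacobiK, jacobiAlpha, jacobiBeta, jacobiAct]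
  rw [Real.sqrt_div (ha _).le, Real.sqrt_div (ha _).le, Real.sqrt_mul (ha _).le]
  push_cast
  rw [hsq n, hsq (n + 1)]
  have h0 := hr n
  have h1 := hr (n + 1)
  have h2 := hr (n + 1 + 1)
  field_simp
  ring

theorem memℓp_two_iff {u : ℕ → ℂ} : Memℓp u 2 ↔ Summable fun n => ‖u n‖ ^ 2 := by
  rw [memℓp_gen_iff (by norm_num)]
  simp

theorem jacobi_exists_coeffs (ha : ∀ n, 0 < a n) (hsum : Summable fun n => (a n)⁻¹)
    {β₀ : ℝ} (hk : Summable fun n => |jacobiK a n - 1|) {z : ℕ → ℂ} {zl : ℂ} {φ : ℕ → ℝ}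
    (hP : IsPhaseSequence (fun n => Complex.exp (Complex.I * φ n)) z zl)
    (hz : ∀ᶠ n in atTop, z n + (z n)⁻¹ = 2 * jacobiBeta β₀ a b n) {u : ℕ → ℂ}
    (hu : Memℓp (jacobiAct a b u) 2) : ∃ s t, HasAsymptoticCoeffs a φ u s t := by
  simp only [hasAsymptoticCoeffs_iff ha]
  refine (jacobi_perturbedRecurrence ha hz u).exists_asymptotics hP
    (by simpa only [Complex.norm_real, Real.norm_eq_abs] using hk) ?_
  have h1 := (summable_nat_add_iff 1).2 (memℓp_two_iff.1 hu)
  refine Summable.of_nonneg_of_le (fun n => norm_nonneg _) (fun n => ?_) (h1.add hsum)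
  have h2 : (√(a n))⁻¹ ^ 2 = (a n)⁻¹ := by rw [inv_pow, Real.sq_sqrt (ha n).le]
  rw [← h2, norm_div, Complex.norm_real, Real.norm_of_nonneg (Real.sqrt_nonneg _), div_eq_mul_inv]
  have : 0 ≤ (√(a n))⁻¹ := by positivity
  -- The arithmetic-geometric mean inequality: a product of two `ℓ²` sequences is summable.
  nlinarith [norm_nonneg (jacobiAct a b u (n + 1)), sq_nonneg (‖jacobiAct a b u (n + 1)‖ -
    (√(a n))⁻¹), mul_nonneg (norm_nonneg (jacobiAct a b u (n + 1))) this]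

/-- The partial products of the `k_n` telescope to `α_0 / α_n`, and the infinite product converges
to a non-zero limit. The factor `α_n⁻¹` relates the Wronskian of `u` to the Casoratian of `√(a_n)
u_n`. -/
theorem tendsto_jacobiAlpha_inv (ha : ∀ n, 0 < a n) (hk : Summable fun n => |jacobiK a n - 1|) :
    ∃ L : ℝ, L ≠ 0 ∧ Tendsto (fun n => (jacobiAlpha a n)⁻¹) atTop (𝓝 L) := by
  have hα : ∀ n, 0 < jacobiAlpha a n := fun n =>
    Real.sqrt_pos.2 (div_pos (ha _) (ha _))
  have hm := (Real.multipliable_one_add_of_summable hk.of_abs)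
  have hne : ∏' n, (1 + (jacobiK a n - 1)) ≠ 0 := by
    refine tprod_one_add_ne_zero_of_summable (fun n => ?_) hk
    rw [add_sub_cancel]
    exact (div_pos (hα _) (hα _)).ne'
  refine ⟨(jacobiAlpha a 0)⁻¹ * ∏' n, (1 + (jacobiK a n - 1)),
    mul_ne_zero (inv_ne_zero (hα 0).ne') hne, ?_⟩
  refine (hm.hasProd.tendsto_prod_nat.const_mul _).congr fun n => ?_
  induction n with
  | zero => simp
  | succ n ih =>
    rw [Finset.prod_range_succ, ← mul_assoc, ih, add_sub_cancel, jacobiK]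
    have := (hα n).ne'
    field_simp

theorem tendsto_jacobiWronskian (ha : ∀ n, 0 < a n) {L : ℝ}
    (hL : Tendsto (fun n => (jacobiAlpha a n)⁻¹) atTop (𝓝 L)) {z : ℕ → ℂ} {zl : ℂ} {φ : ℕ → ℝ}
    (hP : IsPhaseSequence (fun n => Complex.exp (Complex.I * φ n)) z zl) {u v : ℕ → ℂ}
    {s t s' t' : ℂ} (hu : HasAsymptoticCoeffs a φ u s t) (hv : HasAsymptoticCoeffs a φ v s' t') :
    Tendsto (jacobiWronskian a u v) atTop
      (𝓝 (L * (-(zl - zl⁻¹) * (conj s * s' - conj t * t')))) := by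
  rw [hasAsymptoticCoeffs_iff ha] at hu hv
  refine (((Complex.continuous_ofReal.tendsto L).comp hL).mul
    (hP.tendsto_casoratian hu hv)).congr fun n => ?_
  have hr : ∀ n, (√(a n) : ℂ) ≠ 0 := fun n => by
    exact_mod_cast (Real.sqrt_pos.2 (ha n)).ne'
  have hsq : (a n : ℂ) = (√(a n) : ℂ) ^ 2 := by
    exact_mod_cast (Real.sq_sqrt (ha n).le).symm
  simp only [Function.comp_apply, jacobiAlpha, jacobiWronskian, Real.sqrt_div (ha _).le, map_mul,
    Complex.conj_ofReal, hsq]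
  push_cast
  have h0 := hr n
  have h1 := hr (n + 1)
  field_simp
end

/-! ### The phases built from `arccos β_n`. -/

theorem exp_I_mul_arccos {x : ℝ} (hx : |x| ≤ 1) :
    Complex.exp (Complex.I * Real.arccos x) = x + Complex.I * √(1 - x ^ 2) := by
  rw [mul_comm, Complex.exp_mul_I, ← Complex.ofReal_cos, ← Complex.ofReal_sin,
    Real.cos_arccos (abs_le.1 hx).1 (abs_le.1 hx).2, Real.sin_arccos, mul_comm]

theorem norm_exp_I_mul_ofReal (x : ℝ) : ‖Complex.exp (Complex.I * x)‖ = 1 := by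
  rw [mul_comm, Complex.norm_exp_ofReal_mul_I]

/-- Away from `±1` the function `√(1 - x²)` is Lipschitz, so bounded variation passes from `β_n` to
`z_n`. -/
theorem norm_exp_arccos_sub_le {x y r : ℝ} (hr : r < 1) (hx : |x| ≤ r) (hy : |y| ≤ r) :
    ‖Complex.exp (Complex.I * Real.arccos x) - Complex.exp (Complex.I * Real.arccos y)‖ ≤
      (1 + 1 / √(1 - r ^ 2)) * |x - y| := by
  have hr0 : 0 ≤ r := (abs_nonneg x).trans hx
  have hc : 0 < √(1 - r ^ 2) := Real.sqrt_pos.2 (by nlinarith)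
  set c := √(1 - r ^ 2)
  have hsq : ∀ w : ℝ, |w| ≤ r → w ^ 2 ≤ r ^ 2 := fun w hw => by
    rw [← sq_abs w]; gcongr
  have hsx : c ≤ √(1 - x ^ 2) := Real.sqrt_le_sqrt (by linarith [hsq x hx])
  have hsy : c ≤ √(1 - y ^ 2) := Real.sqrt_le_sqrt (by linarith [hsq y hy])
  have h1 : √(1 - x ^ 2) ^ 2 = 1 - x ^ 2 := Real.sq_sqrt (by nlinarith [hsq x hx])
  have h2 : √(1 - y ^ 2) ^ 2 = 1 - y ^ 2 := Real.sq_sqrt (by nlinarith [hsq y hy])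
  have key : |√(1 - x ^ 2) - √(1 - y ^ 2)| ≤ 1 / c * |x - y| := by
    rw [div_mul_eq_mul_div, one_mul, le_div_iff₀ hc]
    have e : (√(1 - x ^ 2) - √(1 - y ^ 2)) * (√(1 - x ^ 2) + √(1 - y ^ 2)) =
        (x - y) * -(x + y) := by linear_combination h1 - h2
    have e' := congrArg abs e
    rw [abs_mul, abs_mul, abs_neg, abs_of_pos (by linarith : 0 < √(1 - x ^ 2) + √(1 - y ^ 2))] at e'
    have h3 : |x + y| ≤ 2 := (abs_add_le x y).trans (by linarith)
    nlinarith [abs_nonneg (√(1 - x ^ 2) - √(1 - y ^ 2)), abs_nonneg (x - y)]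
  rw [exp_I_mul_arccos (hx.trans hr.le), exp_I_mul_arccos (hy.trans hr.le)]
  have e : (x + Complex.I * √(1 - x ^ 2) - (y + Complex.I * √(1 - y ^ 2)) : ℂ) =
      ((x - y : ℝ) : ℂ) + Complex.I * ((√(1 - x ^ 2) - √(1 - y ^ 2) : ℝ) : ℂ) := by
    push_cast; ring
  rw [e]
  refine (norm_add_le _ _).trans ?_
  rw [norm_mul, Complex.norm_I, Complex.norm_real, Complex.norm_real, Real.norm_eq_abs,
    Real.norm_eq_abs]
  linarith

theorem exists_isPhaseSequence {a b : ℕ → ℝ} {β₀ β_inf : ℝ}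
    (hβ : Tendsto (jacobiBeta β₀ a b) atTop (𝓝 β_inf)) (hβ_inf : |β_inf| < 1)
    (hβ' : Summable fun n => |jacobiBeta β₀ a b (n + 1) - jacobiBeta β₀ a b n|) :
    ∃ z zl, IsPhaseSequence (fun n => Complex.exp (Complex.I * jacobiPhase β₀ a b n)) z zl ∧
      ∀ᶠ n in atTop, z n + (z n)⁻¹ = 2 * jacobiBeta β₀ a b n := by
  obtain ⟨r, hr, hr1⟩ := exists_between hβ_inf
  have hev : ∀ᶠ n in atTop, |jacobiBeta β₀ a b n| ≤ r :=
    (hβ.abs.eventually_lt_const hr).mono fun n hn => hn.le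
  have hinv : ∀ x : ℝ, (Complex.exp (Complex.I * Real.arccos x))⁻¹ =
      Complex.exp (-(Real.arccos x : ℂ) * Complex.I) := fun x => by
    rw [← Complex.exp_neg]; congr 1; ring
  refine ⟨fun n => Complex.exp (Complex.I * Real.arccos (jacobiBeta β₀ a b n)),
    Complex.exp (Complex.I * Real.arccos β_inf),
    ⟨fun n => norm_exp_I_mul_ofReal _, fun n => norm_exp_I_mul_ofReal _, ?_, ?_, ?_, ?_⟩, ?_⟩
  · filter_upwards [hev] with n hn
    rw [← Complex.exp_add, ← mul_add]
    unfold jacobiPhase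
    -- Since eventually `|β_n| ≤ r < 1`, the index `n` passes the filter in the phase.
    rw [Finset.range_add_one, Finset.filter_insert, if_pos (hn.trans hr1.le),
      Finset.sum_insert (by simp)]
    push_cast
    rw [add_comm]
  · have h : Continuous fun x : ℝ => Complex.exp (Complex.I * Real.arccos x) := by
      have := Real.continuous_arccos
      fun_prop
    exact (h.tendsto _).comp hβ
  · have him : (Complex.exp (Complex.I * Real.arccos β_inf)).im ≠ 0 := by
      rw [exp_I_mul_arccos hβ_inf.le]
      have : β_inf ^ 2 < 1 := by rw [← sq_abs]; nlinarith [abs_nonneg β_inf]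
      simpa using (Real.sqrt_pos.2 (by linarith : 0 < 1 - β_inf ^ 2)).ne'
    rw [← conj_eq_inv_of_norm_eq_one (norm_exp_I_mul_ofReal _), Complex.sub_conj]
    simpa using him
  · refine Summable.of_norm_bounded_eventually_nat (hβ'.mul_left (1 + 1 / √(1 - r ^ 2))) ?_
    filter_upwards [hev, (tendsto_add_atTop_nat 1).eventually hev] with n h1 h2
    rw [norm_norm]
    exact norm_exp_arccos_sub_le hr1 h2 h1
  · filter_upwards [hev] with n hn
    have hn' := abs_le.1 (hn.trans hr1.le)
    rw [hinv, mul_comm, ← Complex.two_cos, ← Complex.ofReal_cos, Real.cos_arccos hn'.1 hn'.2]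

/-! ### Solutions of the homogeneous recurrence. -/

/-- The solution of the Jacobi recurrence with given initial data. -/
noncomputable def jacobiSolution (a b : ℕ → ℝ) (c d : ℂ) : ℕ → ℂ
  | 0 => c
  | 1 => d
  | n + 2 => -(a n * jacobiSolution a b c d n + b (n + 1) * jacobiSolution a b c d (n + 1)) /
      a (n + 1)

section
variable {a b : ℕ → ℝ}

theorem jacobiAct_jacobiSolution (ha : ∀ n, 0 < a n) (c d : ℂ) (n : ℕ) :
    jacobiAct a b (jacobiSolution a b c d) (n + 1) = 0 := by
  have : (a (n + 1) : ℂ) ≠ 0 := by exact_mod_cast (ha (n + 1)).ne'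
  simp only [jacobiAct, jacobiSolution]
  field_simp
  ring

theorem memℓp_jacobiAct_of_forall_succ {u : ℕ → ℂ} (hu : ∀ n, jacobiAct a b u (n + 1) = 0) :
    Memℓp (jacobiAct a b u) 2 := by
  rw [memℓp_two_iff, ← summable_nat_add_iff 1]
  simp [hu]

theorem jacobiWronskian_eq_zero_index {u v : ℕ → ℂ} (hu : ∀ n, jacobiAct a b u (n + 1) = 0)
    (hv : ∀ n, jacobiAct a b v (n + 1) = 0) (n : ℕ) :
    jacobiWronskian a u v n = jacobiWronskian a u v 0 := by
  rw [← sum_green a b, ← sum_green a b, Finset.sum_range_succ', Finset.sum_range_succ']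
  simp [hu, hv]

theorem memℓp_of_hasAsymptoticCoeffs (ha : ∀ n, 0 < a n) (hsum : Summable fun n => (a n)⁻¹)
    {φ : ℕ → ℝ} {u : ℕ → ℂ} {s t : ℂ} (h : HasAsymptoticCoeffs a φ u s t) : Memℓp u 2 := by
  obtain ⟨ε, hε, h⟩ := h
  obtain ⟨C, hC⟩ := hε.norm.bddAbove_range
  rw [memℓp_two_iff]
  refine Summable.of_nonneg_of_le (fun n => by positivity) (fun n => ?_)
    (hsum.mul_right ((‖s‖ + ‖t‖ + C) ^ 2))
  rw [h n, norm_mul, mul_pow, Complex.norm_real, Real.norm_of_nonneg (by positivity), inv_pow,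
    Real.sq_sqrt (ha n).le]
  have hb := norm_add₃_le (a := s * Complex.exp (Complex.I * φ n))
    (b := t * Complex.exp (-(Complex.I * φ n))) (c := ε n)
  rw [norm_mul, norm_mul, Complex.exp_neg, norm_inv, norm_exp_I_mul_ofReal, inv_one, mul_one,
    mul_one, ← Complex.exp_neg] at hb
  have := hC ⟨n, rfl⟩
  have := (ha n).le
  gcongr
  exact hb.trans (by simpa using hC ⟨n, rfl⟩)

theorem HasAsymptoticCoeffs.linear_combination {φ : ℕ → ℝ} {u v : ℕ → ℂ} {s t s' t' : ℂ}
    (hu : HasAsymptoticCoeffs a φ u s t) (hv : HasAsymptoticCoeffs a φ v s' t') (c d : ℂ) :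
    HasAsymptoticCoeffs a φ (c • u + d • v) (c * s + d * s') (c * t + d * t') := by
  obtain ⟨ε, hε, hu⟩ := hu
  obtain ⟨ε', hε', hv⟩ := hv
  refine ⟨fun n => c * ε n + d * ε' n, by simpa using (hε.const_mul c).add (hε'.const_mul d),
    fun n => ?_⟩
  simp only [Pi.add_apply, Pi.smul_apply, smul_eq_mul, hu, hv]
  ring

/-- In the limit circle case every boundary condition is attained by a solution of the Jacobi
recurrence with non-zero boundary values. -/
theorem exists_solution_of_boundary (ha : ∀ n, 0 < a n) {φ : ℕ → ℝ} {L : ℝ}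
    (hL : Tendsto (fun n => (jacobiAlpha a n)⁻¹) atTop (𝓝 L)) {z : ℕ → ℂ} {zl : ℂ}
    (hP : IsPhaseSequence (fun n => Complex.exp (Complex.I * φ n)) z zl)
    (hex : ∀ u : ℕ → ℂ, Memℓp (jacobiAct a b u) 2 → ∃ s t, HasAsymptoticCoeffs a φ u s t)
    (ω : ℂ) :
    ∃ u s t, (∀ n, jacobiAct a b u (n + 1) = 0) ∧ HasAsymptoticCoeffs a φ u s t ∧
      s = ω * t ∧ t ≠ 0 := by
  set P := jacobiSolution a b 1 0
  set Q := jacobiSolution a b 0 1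
  have hP0 : ∀ n, jacobiAct a b P (n + 1) = 0 := jacobiAct_jacobiSolution ha 1 0
  have hQ0 : ∀ n, jacobiAct a b Q (n + 1) = 0 := jacobiAct_jacobiSolution ha 0 1
  obtain ⟨p, p', hp⟩ := hex P (memℓp_jacobiAct_of_forall_succ hP0)
  obtain ⟨q, q', hq⟩ := hex Q (memℓp_jacobiAct_of_forall_succ hQ0)
  obtain ⟨c, d, hcd, h0⟩ : ∃ c d : ℂ, c * (p - ω * p') + d * (q - ω * q') = 0 ∧
      ¬(c = 0 ∧ d = 0) := by
    by_cases h : p - ω * p' = 0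
    · exact ⟨1, 0, by simp [h], by simp⟩
    · exact ⟨q - ω * q', -(p - ω * p'), by ring, fun hh => h (neg_eq_zero.1 hh.2)⟩
  have hu0 : ∀ n, jacobiAct a b (c • P + d • Q) (n + 1) = 0 := fun n => by
    rw [jacobiAct_add, jacobiAct_smul, jacobiAct_smul]
    simp [hP0, hQ0]
  have hu := hp.linear_combination hq c d
  refine ⟨c • P + d • Q, _, _, hu0, hu, by linear_combination hcd, fun ht => h0 ?_⟩
  have hs : c * p + d * q = 0 := by linear_combination hcd + ω * ht
  -- If `s = t = 0`, the Wronskian with any solution is constant and tends to `0`. Testing with `P`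
  -- and `Q` at index `0` gives `d = 0` and `c = 0`.
  have hW : ∀ v s' t', (∀ n, jacobiAct a b v (n + 1) = 0) → HasAsymptoticCoeffs a φ v s' t' →
      jacobiWronskian a (c • P + d • Q) v 0 = 0 := by
    intro v s' t' hv0 hv
    have h := tendsto_jacobiWronskian ha hL hP hu hv
    rw [hs, ht] at h
    simp only [map_zero, zero_mul, sub_zero, mul_zero] at h
    exact tendsto_nhds_unique
      (tendsto_const_nhds.congr fun n => (jacobiWronskian_eq_zero_index hu0 hv0 n).symm) h
  have h1 := hW P p p' hP0 hp
  have h2 := hW Q q q' hQ0 hq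
  have ha0 := (ha 0).ne'
  simp [jacobiWronskian, P, Q, jacobiSolution, ha0] at h1 h2
  exact ⟨h2, h1⟩

/-! ### The boundary form and adjoints. -/

theorem tendsto_jacobiWronskian_inner (u v : (jacobiMax a b).domain) :
    Tendsto (jacobiWronskian a (u : EllTwo) (v : EllTwo)) atTop
      (𝓝 (inner ℂ (jacobiMax a b u) (v : EllTwo) - inner ℂ (u : EllTwo) (jacobiMax a b v))) := by
  have h := (lp.hasSum_inner (𝕜 := ℂ) (jacobiMax a b u) (v : EllTwo)).sub
    (lp.hasSum_inner (𝕜 := ℂ) (u : EllTwo) (jacobiMax a b v))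
  refine (h.tendsto_sum_nat.comp (tendsto_add_atTop_nat 1)).congr fun n => ?_
  rw [← sum_green a b]
  refine Finset.sum_congr rfl fun m _ => ?_
  rw [jacobiMax_apply, jacobiMax_apply, RCLike.inner_apply, RCLike.inner_apply]
  ring

theorem single_mem_finiteVectors (n : ℕ) (c : ℂ) :
    (lp.single 2 n c : EllTwo) ∈ finiteVectors := by
  refine (Set.finite_singleton n).subset fun m hm => ?_
  by_contra h
  exact hm (by rw [lp.single_apply_ne _ _ _ h])

theorem jacobiMin_domain : (jacobiMin a b).domain = finiteVectors :=
  Submodule.ext fun u => mem_jacobiMin_domain a b u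

theorem dense_finiteVectors : Dense (finiteVectors : Set EllTwo) := fun u =>
  mem_closure_of_tendsto (lp.hasSum_single (by norm_num) u)
    (Eventually.of_forall fun s => sum_mem fun i _ => single_mem_finiteVectors i _)

/-- If `T` lies between the minimal and the maximal operator, its adjoint is a restriction of the
maximal operator. -/
theorem adjoint_le_jacobiMax {T : EllTwo →ₗ.[ℂ] EllTwo} (hmin : jacobiMin a b ≤ T) :
    T.adjoint ≤ jacobiMax a b := by
  have hd : Dense (T.domain : Set EllTwo) :=
    dense_finiteVectors.mono (by rw [← jacobiMin_domain (a := a) (b := b)]; exact hmin.1)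
  have key : ∀ v : T.adjoint.domain, jacobiAct a b (v : EllTwo) = (T.adjoint v : EllTwo) := by
    intro v
    funext n
    -- Testing the adjoint relation against the `n`-th unit vector reads off the `n`-th component.
    have hf := single_mem_finiteVectors n 1
    have hmem := hf
    rw [← jacobiMin_domain (a := a) (b := b)] at hmem
    have hadj := LinearPMap.adjoint_isFormalAdjoint hd v ⟨_, hmin.1 hmem⟩
    have hTe : T ⟨_, hmin.1 hmem⟩ = jacobiMax a b ⟨_, hmem.2⟩ :=
      (hmin.2 (x := ⟨_, hmem⟩) (y := ⟨_, hmin.1 hmem⟩) rfl).symm.trans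
        (LinearPMap.domRestrict_apply rfl)
    rw [hTe, lp.inner_single_right] at hadj
    have hsum := (lp.hasSum_inner (𝕜 := ℂ) (v : EllTwo) (jacobiMax a b ⟨_, hmem.2⟩)).tendsto_sum_nat
    have hconst : Tendsto (fun _ : ℕ => conj (jacobiAct a b (v : EllTwo) n)) atTop
        (𝓝 (inner ℂ (v : EllTwo) (jacobiMax a b ⟨_, hmem.2⟩))) := by
      refine (hsum.comp (tendsto_add_atTop_nat 1)).congr' ?_
      filter_upwards [eventually_gt_atTop n] with N hN
      have hg := sum_green a b (v : EllTwo) (lp.single 2 n 1 : EllTwo) N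
      have hz : ∀ m, m ≠ n → (lp.single 2 n (1 : ℂ) : EllTwo) m = 0 := fun m hm =>
        lp.single_apply_ne _ _ _ hm
      have hw : jacobiWronskian a (v : EllTwo) (lp.single 2 n (1 : ℂ) : EllTwo) N = 0 := by
        simp only [jacobiWronskian, hz N (by omega), hz (N + 1) (by omega)]
        simp
      rw [hw, Finset.sum_sub_distrib, sub_eq_zero, Finset.sum_eq_single n
        (fun m _ hm => by rw [hz m hm, mul_zero]) (fun h => absurd (by simp; omega) h),
        lp.single_apply_self, mul_one] at hg
      rw [hg, Function.comp_apply]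
      refine Finset.sum_congr rfl fun m _ => ?_
      rw [jacobiMax_apply, RCLike.inner_apply, mul_comm]
    have := tendsto_nhds_unique hconst tendsto_const_nhds
    rw [← hadj, RCLike.inner_apply, one_mul] at this
    exact (starRingEnd ℂ).injective this.symm
  refine ⟨fun v hv => ?_, fun v w hvw => ?_⟩
  · rw [mem_jacobiMax_domain, key ⟨v, hv⟩]
    exact lp.memℓp _
  · refine Subtype.ext ?_
    rw [jacobiMax_apply, ← hvw, key v]
end

/-! ### Self-adjoint restrictions and boundary conditions. -/

section
variable {a b : ℕ → ℝ}

theorem hasAsymptoticCoeffs_zero_of_finite (ha : ∀ n, 0 < a n) {φ : ℕ → ℝ} {u : ℕ → ℂ}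
    (hu : (Function.support u).Finite) : HasAsymptoticCoeffs a φ u 0 0 := by
  rw [hasAsymptoticCoeffs_iff ha]
  obtain ⟨N, hN⟩ := hu.bddAbove
  refine tendsto_const_nhds.congr' ?_
  filter_upwards [eventually_gt_atTop N] with n hn
  have : u n = 0 := by
    by_contra h
    exact absurd (hN h) (not_le.2 hn)
  simp [this]

theorem jacobiMin_le_jacobiOmega (ha : ∀ n, 0 < a n) (β₀ : ℝ) (ω : ℂ) :
    jacobiMin a b ≤ jacobiOmega β₀ a b ω :=
  ⟨fun _ hu => ⟨⟨0, 0, hasAsymptoticCoeffs_zero_of_finite ha hu.1, by simp⟩, hu.2⟩,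
    fun u w huv => congrArg (jacobiMax a b)
      (Subtype.ext huv : (⟨u, u.2.2⟩ : (jacobiMax a b).domain) = ⟨w, w.2.2⟩)⟩

/-- The asymptotic coefficients satisfy Green's formula: the boundary form of the maximal operator
is a non-zero multiple of `conj s₊ s₊' - conj s₋ s₋'`. -/
def HasBoundaryForm (a b φ : ℕ → ℝ) : Prop :=
  ∃ c : ℂ, c ≠ 0 ∧ ∀ (u v : (jacobiMax a b).domain) (s t s' t' : ℂ),
    HasAsymptoticCoeffs a φ (u : EllTwo) s t → HasAsymptoticCoeffs a φ (v : EllTwo) s' t' →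
    inner ℂ (jacobiMax a b u) (v : EllTwo) - inner ℂ (u : EllTwo) (jacobiMax a b v) =
      c * (conj s * s' - conj t * t')

theorem hasBoundaryForm_of_isPhaseSequence (ha : ∀ n, 0 < a n) {L : ℝ} (hL0 : L ≠ 0)
    (hL : Tendsto (fun n => (jacobiAlpha a n)⁻¹) atTop (𝓝 L)) {φ : ℕ → ℝ} {z : ℕ → ℂ} {zl : ℂ}
    (hP : IsPhaseSequence (fun n => Complex.exp (Complex.I * φ n)) z zl) :
    HasBoundaryForm a b φ := by
  refine ⟨L * -(zl - zl⁻¹), mul_ne_zero (by exact_mod_cast hL0) (neg_ne_zero.2 hP.limit_ne),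
    fun u v s t s' t' hu hv => ?_⟩
  rw [mul_assoc]
  exact tendsto_nhds_unique (tendsto_jacobiWronskian_inner u v)
    (tendsto_jacobiWronskian ha hL hP hu hv)

theorem conj_mul_self_of_norm_eq_one {ω : ℂ} (hω : ‖ω‖ = 1) : conj ω * ω = 1 := by
  rw [conj_eq_inv_of_norm_eq_one hω, inv_mul_cancel₀ (ne_zero_of_norm_eq_one hω)]

/-- Symmetry holds because the form vanishes on the line `s = ω t`. Conversely, one test vector with
`t ≠ 0` forces the boundary condition on every vector in the domain of the adjoint. -/
theorem isSelfAdjoint_jacobiOmega (ha : ∀ n, 0 < a n) {β₀ : ℝ}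
    (hB : HasBoundaryForm a b (jacobiPhase β₀ a b))
    (hex : ∀ u : ℕ → ℂ, Memℓp (jacobiAct a b u) 2 →
      ∃ s t, HasAsymptoticCoeffs a (jacobiPhase β₀ a b) u s t) {ω : ℂ}
    (hsol : ∃ (u : (jacobiMax a b).domain) (s t : ℂ),
      HasAsymptoticCoeffs a (jacobiPhase β₀ a b) (u : EllTwo) s t ∧ s = ω * t ∧ t ≠ 0)
    (hω : ‖ω‖ = 1) : IsSelfAdjoint (jacobiOmega β₀ a b ω) := by
  obtain ⟨c, hc, hB⟩ := hB
  have hωω := conj_mul_self_of_norm_eq_one hω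
  have hmin := jacobiMin_le_jacobiOmega (b := b) ha β₀ ω
  have hd : Dense ((jacobiOmega β₀ a b ω).domain : Set EllTwo) :=
    dense_finiteVectors.mono (by rw [← jacobiMin_domain (a := a) (b := b)]; exact hmin.1)
  have happ : ∀ u : (jacobiOmega β₀ a b ω).domain,
      jacobiOmega β₀ a b ω u = jacobiMax a b ⟨u, u.2.2⟩ := fun u =>
    LinearPMap.domRestrict_apply rfl
  rw [LinearPMap.isSelfAdjoint_def]
  have hadj := adjoint_le_jacobiMax hmin
  have hle : (jacobiOmega β₀ a b ω).adjoint ≤ jacobiOmega β₀ a b ω := by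
    refine ⟨fun v hv => ?_, fun v w hvw => by rw [happ]; exact hadj.2 (by exact hvw)⟩
    have hvmax := hadj.1 hv
    refine ⟨?_, hvmax⟩
    obtain ⟨s', t', hv'⟩ := hex _ hvmax
    obtain ⟨u, s, t, hu, hst, ht⟩ := hsol
    have h := LinearPMap.adjoint_isFormalAdjoint hd ⟨v, hv⟩ ⟨u, ⟨⟨s, t, hu, hst⟩, u.2⟩⟩
    rw [happ, hadj.2 (x := ⟨v, hv⟩) (y := ⟨v, hvmax⟩) rfl] at h
    have h2 := hB ⟨v, hvmax⟩ u s' t' s t hv' hu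
    rw [h, sub_self, hst] at h2
    have h3 : (conj s' * ω - conj t') * t = 0 := by
      have := (mul_eq_zero.1 h2.symm).resolve_left hc
      linear_combination this
    have h4 := congrArg conj (sub_eq_zero.1 ((mul_eq_zero.1 h3).resolve_right ht))
    rw [map_mul, Complex.conj_conj, Complex.conj_conj] at h4
    exact ⟨s', t', hv', by linear_combination ω * h4 - s' * hωω⟩
  refine le_antisymm hle (LinearPMap.IsFormalAdjoint.le_adjoint hd fun u v => ?_)
  obtain ⟨s, t, hu, hst⟩ := u.2.1
  obtain ⟨s', t', hv, hst'⟩ := v.2.1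
  have h := hB ⟨u, u.2.2⟩ ⟨v, v.2.2⟩ s t s' t' hu hv
  rw [happ, happ, ← sub_eq_zero, h, hst, hst', map_mul]
  linear_combination (c * (conj t * t')) * hωω

/-- Symmetry makes the coefficient pairs isotropic: `‖s‖ = ‖t‖`, and one pair with `t ≠ 0` fixes the
ratio `ω = s / t` for all others. -/
theorem exists_jacobiOmega_of_isFormalAdjoint {β₀ : ℝ}
    (hB : HasBoundaryForm a b (jacobiPhase β₀ a b))
    (hex : ∀ u : ℕ → ℂ, Memℓp (jacobiAct a b u) 2 →
      ∃ s t, HasAsymptoticCoeffs a (jacobiPhase β₀ a b) u s t)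
    {J : EllTwo →ₗ.[ℂ] EllTwo} (hJ : J.IsFormalAdjoint J) (hmax : J ≤ jacobiMax a b) :
    ∃ ω : ℂ, ‖ω‖ = 1 ∧ J ≤ jacobiOmega β₀ a b ω := by
  obtain ⟨c, hc, hB⟩ := hB
  have hform : ∀ (u v : J.domain) (s t s' t' : ℂ),
      HasAsymptoticCoeffs a (jacobiPhase β₀ a b) (u : EllTwo) s t →
      HasAsymptoticCoeffs a (jacobiPhase β₀ a b) (v : EllTwo) s' t' →
      conj s * s' = conj t * t' := by
    intro u v s t s' t' hu hv
    have h := hB ⟨u, hmax.1 u.2⟩ ⟨v, hmax.1 v.2⟩ s t s' t' hu hv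
    rw [← hmax.2 (x := u) (y := ⟨u, hmax.1 u.2⟩) rfl, ← hmax.2 (x := v) (y := ⟨v, hmax.1 v.2⟩) rfl,
      hJ u v, sub_self] at h
    exact sub_eq_zero.1 ((mul_eq_zero.1 h.symm).resolve_left hc)
  have hnorm : ∀ (u : J.domain) (s t : ℂ),
      HasAsymptoticCoeffs a (jacobiPhase β₀ a b) (u : EllTwo) s t → ‖s‖ = ‖t‖ := by
    intro u s t hu
    have h := hform u u s t s t hu hu
    rw [mul_comm, Complex.mul_conj, mul_comm, Complex.mul_conj, Complex.normSq_eq_norm_sq,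
      Complex.normSq_eq_norm_sq] at h
    exact (sq_eq_sq₀ (norm_nonneg _) (norm_nonneg _)).1 (by exact_mod_cast h)
  suffices h : ∃ ω : ℂ, ‖ω‖ = 1 ∧ ∀ (u : J.domain) (s t : ℂ),
      HasAsymptoticCoeffs a (jacobiPhase β₀ a b) (u : EllTwo) s t → s = ω * t by
    obtain ⟨ω, hω, h⟩ := h
    refine ⟨ω, hω, fun u hu => ?_, fun u v huv => ?_⟩
    · obtain ⟨s, t, hst⟩ := hex u (hmax.1 hu)
      exact ⟨⟨s, t, hst, h ⟨u, hu⟩ s t hst⟩, hmax.1 hu⟩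
    · refine (hmax.2 (x := u) (y := ⟨u, hmax.1 u.2⟩) rfl).trans ?_
      exact (LinearPMap.domRestrict_apply huv.symm).symm
  by_cases h0 : ∃ (u : J.domain) (s t : ℂ),
      HasAsymptoticCoeffs a (jacobiPhase β₀ a b) (u : EllTwo) s t ∧ t ≠ 0
  · obtain ⟨u, s, t, hu, ht⟩ := h0
    have hω : ‖s / t‖ = 1 := by
      rw [norm_div, hnorm u s t hu, div_self (norm_ne_zero_iff.2 ht)]
    refine ⟨s / t, hω, fun v s' t' hv => ?_⟩
    have h1 := hform u v s t s' t' hu hv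
    have h2 : conj (s / t) * s' = t' := by
      rw [map_div₀, div_mul_eq_mul_div, h1, mul_div_cancel_left₀ _ ((map_ne_zero _).2 ht)]
    linear_combination (s / t) * h2 - s' * conj_mul_self_of_norm_eq_one hω
  -- All coefficients vanish here, so any unimodular `ω` serves.
  · push Not at h0
    refine ⟨1, norm_one, fun u s t hu => ?_⟩
    have ht := h0 u s t hu
    have := hnorm u s t hu
    rw [ht, norm_zero, norm_eq_zero] at this
    simp [this, ht]
end

/-! ### The main theorem. -/

theorem theorem3p9 (a b : ℕ → ℝ) (β₀ β_inf : ℝ) (ha : ∀ n, 0 < a n)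
    (hsum : Summable fun n => (a n)⁻¹)
    (hβ : Tendsto (jacobiBeta β₀ a b) atTop (𝓝 β_inf)) (hβ_inf : |β_inf| < 1)
    (hk : Summable fun n => |jacobiK a n - 1|)
    (hβ' : Summable fun n => |jacobiBeta β₀ a b (n + 1) - jacobiBeta β₀ a b n|) :
    (∀ u ∈ (jacobiMax a b).domain, ∃! s : ℂ × ℂ,
      HasAsymptoticCoeffs a (jacobiPhase β₀ a b) (u : ℕ → ℂ) s.1 s.2) ∧
    (∀ ω : ℂ, ‖ω‖ = 1 → IsSelfAdjoint (jacobiOmega β₀ a b ω)) ∧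
    (∀ J : EllTwo →ₗ.[ℂ] EllTwo, jacobiMin a b ≤ J → IsSelfAdjoint J → J ≤ jacobiMax a b →
      ∃ ω : ℂ, ‖ω‖ = 1 ∧ J = jacobiOmega β₀ a b ω) := by
  obtain ⟨z, zl, hP, hz⟩ := exists_isPhaseSequence hβ hβ_inf hβ'
  obtain ⟨L, hL0, hL⟩ := tendsto_jacobiAlpha_inv ha hk
  have hex : ∀ u : ℕ → ℂ, Memℓp (jacobiAct a b u) 2 →
      ∃ s t, HasAsymptoticCoeffs a (jacobiPhase β₀ a b) u s t := fun u hu =>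
    jacobi_exists_coeffs ha hsum hk hP hz hu
  have hB : HasBoundaryForm a b (jacobiPhase β₀ a b) :=
    hasBoundaryForm_of_isPhaseSequence ha hL0 hL hP
  have hself : ∀ ω : ℂ, ‖ω‖ = 1 → IsSelfAdjoint (jacobiOmega β₀ a b ω) := by
    intro ω hω
    refine isSelfAdjoint_jacobiOmega ha hB hex ?_ hω
    obtain ⟨u, s, t, hu0, hu, hst, ht⟩ := exists_solution_of_boundary ha hL hP hex ω
    exact ⟨⟨⟨u, memℓp_of_hasAsymptoticCoeffs ha hsum hu⟩, memℓp_jacobiAct_of_forall_succ hu0⟩,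
      s, t, hu, hst, ht⟩
  refine ⟨fun u hu => ?_, hself, fun J hmin hJ hmax => ?_⟩
  · obtain ⟨s, t, hst⟩ := hex u hu
    refine ⟨(s, t), hst, fun p hp => ?_⟩
    rw [hasAsymptoticCoeffs_iff ha] at hst hp
    obtain ⟨h1, h2⟩ := hP.coeffs_unique hp hst
    exact Prod.ext h1 h2
  · have hJ' := LinearPMap.isSelfAdjoint_def.1 hJ
    have hJf : J.IsFormalAdjoint J := by
      have := LinearPMap.adjoint_isFormalAdjoint hJ.dense_domain
      rwa [hJ'] at this
    obtain ⟨ω, hω, hle⟩ := exists_jacobiOmega_of_isFormalAdjoint hB hex hJf hmax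
    -- A self-adjoint operator has no proper symmetric extension: `J ≤ J_ω` and symmetry of `J_ω`
    -- give `J_ω ≤ J* = J`.
    refine ⟨ω, hω, le_antisymm hle ?_⟩
    have hO := hself ω hω
    have hOf := LinearPMap.adjoint_isFormalAdjoint hO.dense_domain
    rw [LinearPMap.isSelfAdjoint_def.1 hO] at hOf
    rw [← hJ']
    refine LinearPMap.IsFormalAdjoint.le_adjoint hJ.dense_domain fun u v => ?_
    rw [hle.2 (x := u) (y := ⟨u, hle.1 u.2⟩) rfl]
    exact hOf ⟨u, hle.1 u.2⟩ v
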